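/- Let $k$ be a field of characteristic $0$; a variety means a separated scheme of finite type over $\operatorname{Spec}(k)$ (not necessarily reduced). Let $X$ be a variety over $k$. Let $K_0(var/X)$ be the relative Grothendieck group of varieties over $X$, i.e. the quotient of the free abelian group on isomorphism classes $[Y\to X]$ of morphisms of varieties $Y\to X$ by the subgroup generated by the additivity relations $[Y\to X]=[Z\to Y\to X]+[Y\setminus Z\to Y\to X]$ for all closed subvarieties $Z\subset Y$. Let $Iso^{pr}(var/X)$ be the free abelian group on isomorphism classes of proper morphisms of varieties $[X'\to X]$. Then the canonical homomorphism $Iso^{pr}(var/X)\to K_0(var/X)$, $[X'\to X]\mapsto[X'\to X]$, induces an isomorphism from the quotient of $Iso^{pr}(var/X)$ by the acyclicity relations $$[\emptyset\to X]=0\quad\text{and}\quad[\tilde X'\to X]-[\tilde Z'\to X]=[X'\to X]-[Z'\to X]$$ onto $K_0(var/X)$. Here the second relation is imposed for every cartesian diagram $$\begin{array}{ccccc}\tilde Z'&\longrightarrow&\tilde X'&&\\ \downarrow&&\downarrow{\scriptstyle q}&&\\ Z'&\overset{i}{\longrightarrow}&X'&\longrightarrow&X\end{array}$$ of varieties with $X'\to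 X$ proper, $q$ proper, $i$ a closed embedding, and $q:\tilde X'\setminus\tilde Z'\to X'\setminus Z'$ an isomorphism. -/

import Mathlib

open CategoryTheory AlgebraicGeometry

universe u

namespace RelativeGrothendieck

/-- A variety over the field `k`: a separated scheme of finite type over `Spec k`
(not necessarily reduced), given by its structure morphism `p`. -/
structure IsVariety (k : Type u) [Field k] {X : Scheme.{u}}
    (p : X ⟶ Spec (CommRingCat.of k)) : Prop where
  isSeparated : IsSeparated p
  locallyOfFiniteType : LocallyOfFiniteType p
  quasiCompact : QuasiCompact p

section

variable {k : Type u} [Field k] {X : Scheme.{u}}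

/-- The property of a scheme `Y ⟶ X` over `X` that `Y` is a variety over `k`. -/
def isVar (p : X ⟶ Spec (CommRingCat.of k)) : ObjectProperty (Over X) :=
  fun Y => IsVariety k (Y.hom ≫ p)

/-- The property of a scheme `Y ⟶ X` over `X` that `Y` is a variety over `k` and `Y ⟶ X` is
proper. -/
def isProperVar (p : X ⟶ Spec (CommRingCat.of k)) : ObjectProperty (Over X) :=
  fun Y => IsVariety k (Y.hom ≫ p) ∧ IsProper Y.hom

/-- The category of varieties over `X`. -/
abbrev Var (p : X ⟶ Spec (CommRingCat.of k)) := (isVar p).FullSubcategory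

/-- The category of varieties proper over `X`. -/
abbrev ProperVar (p : X ⟶ Spec (CommRingCat.of k)) := (isProperVar p).FullSubcategory

/-- A variety proper over `X`, regarded as a variety over `X`. -/
def ProperVar.toVar {p : X ⟶ Spec (CommRingCat.of k)} (Y : ProperVar p) : Var p :=
  ⟨Y.obj, Y.property.1⟩

/-- The free abelian group on isomorphism classes of morphisms of varieties `Y ⟶ X`. -/
abbrev IsoVar (p : X ⟶ Spec (CommRingCat.of k)) :=
  FreeAbelianGroup (Quotient (isIsomorphicSetoid (Var p)))

/-- The free abelian group on isomorphism classes of proper morphisms of varieties `Y ⟶ X`. -/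
abbrev IsoPr (p : X ⟶ Spec (CommRingCat.of k)) :=
  FreeAbelianGroup (Quotient (isIsomorphicSetoid (ProperVar p)))

/-- The generator `[Y ⟶ X]` of `IsoVar p`. -/
def varClass {p : X ⟶ Spec (CommRingCat.of k)} (Y : Var p) : IsoVar p :=
  FreeAbelianGroup.of (Quotient.mk (isIsomorphicSetoid (Var p)) Y)

/-- The generator `[Y ⟶ X]` of `IsoPr p`. -/
def properClass {p : X ⟶ Spec (CommRingCat.of k)} (Y : ProperVar p) : IsoPr p :=
  FreeAbelianGroup.of (Quotient.mk (isIsomorphicSetoid (ProperVar p)) Y)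

/-- The open complement of (the image of) a closed immersion. -/
def complement {Z Y : Scheme.{u}} (i : Z ⟶ Y) [IsClosedImmersion i] : Y.Opens :=
  ⟨(Set.range i)ᶜ, i.isClosedEmbedding.isClosed_range.isOpen_compl⟩

/-- The additivity relators `[Y ⟶ X] - [Z ⟶ Y ⟶ X] - [Y ∖ Z ⟶ Y ⟶ X]` for a closed immersion
`i : Z ⟶ Y` (over `X`). Here `Y ∖ Z` is any variety over `X` that is
isomorphic, over `X`, to the open subscheme of `Y` on the complement of `Z`. -/
inductive AddRel (p : X ⟶ Spec (CommRingCat.of k)) : IsoVar p → Prop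
  | mk (Y Z U : Var p) (i : Z.obj ⟶ Y.obj) [IsClosedImmersion i.left]
      (e : U.obj ≅ Over.mk ((complement i.left).ι ≫ Y.obj.hom)) :
      AddRel p (varClass Y - varClass Z - varClass U)

/-- The relative Grothendieck group `K₀(var/X)`. -/
abbrev K0 (p : X ⟶ Spec (CommRingCat.of k)) :=
  IsoVar p ⧸ AddSubgroup.closure {x | AddRel p x}

/-- The acyclicity relators: `[∅ ⟶ X]`, and
`([X̃' ⟶ X] - [Z̃' ⟶ X]) - ([X' ⟶ X] - [Z' ⟶ X])` for every cartesian square (over `X`)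
```
  Z̃' --i'--> X̃'
  |           |
  q'          q
  v           v
  Z' --i-->  X'
```
with `q` proper, `i` a closed immersion, and `q` an isomorphism over `X' ∖ Z'`. In this case
`X̃' ∖ Z̃'` is the preimage of `X' ∖ Z'` under `q`. -/
inductive AcRel (p : X ⟶ Spec (CommRingCat.of k)) : IsoPr p → Prop
  | empty (E : ProperVar p) (h : IsEmpty E.obj.left) : AcRel p (properClass E)
  | square (Xt Zt X' Z' : ProperVar p)
      (i' : Zt.obj ⟶ Xt.obj) (q' : Zt.obj ⟶ Z'.obj)
      (q : Xt.obj ⟶ X'.obj) (i : Z'.obj ⟶ X'.obj)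
      (cart : IsPullback i'.left q'.left q.left i.left)
      [IsProper q.left] [IsClosedImmersion i.left]
      (iso : IsIso (q.left ∣_ complement i.left)) :
      AcRel p ((properClass Xt - properClass Zt) - (properClass X' - properClass Z'))

/-- The quotient of `IsoPr p` by the acyclicity relation. -/
abbrev IsoPrModAc (p : X ⟶ Spec (CommRingCat.of k)) :=
  IsoPr p ⧸ AddSubgroup.closure {x | AcRel p x}

end

end RelativeGrothendieck

/-!
The homomorphism is inverted by extending the tautological class on proper morphisms to an additive
invariant of all varieties over `X`. If `Y` is open in a scheme `P` proper over `X`, additivity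
forces its class to be `[P] - [P ∖ Y]`. The acyclicity relations make this well defined, because two
such `P` are dominated by the closure of `Y` in their fibre product, and additive. Affine varieties
are open in a scheme proper over `X`: embed them into a projective space and take the closure of the
graph. On a general variety the classes of its compactifiable opens form a valuation on a lower set
of the lattice of opens, and inclusion–exclusion extends it to every finite union, hence to the
whole variety. This replaces Nagata's compactification theorem, and no resolution of singularities
enters.
-/

open TopologicalSpace Limits

namespace RelativeGrothendieck

section Valuation

variable {α β G : Type*} [DistribLattice α] [OrderBot α] [DistribLattice β] [OrderBot β]
  [AddCommGroup G]

/-- A valuation on the lower set `Q` of a distributive lattice: a modular function vanishing at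
`⊥`. Modularity is only required of pairs whose join, hence all four terms, lie in `Q`. -/
structure IsValuationOn (Q : LowerSet α) (f : α → G) : Prop where
  map_bot : ⊥ ∈ Q → f ⊥ = 0
  map_sup_add_map_inf : ∀ a b, a ⊔ b ∈ Q → f (a ⊔ b) + f (a ⊓ b) = f a + f b

namespace IsValuationOn

variable {Q : LowerSet α} {f F F' : α → G}

lemma mono {Q' : LowerSet α} (hf : IsValuationOn Q f) (h : Q' ≤ Q) : IsValuationOn Q' f where
  map_bot hbot := hf.map_bot (h hbot)
  map_sup_add_map_inf a b hab := hf.map_sup_add_map_inf a b (h hab)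

lemma add (hF : IsValuationOn Q F) (hF' : IsValuationOn Q F') : IsValuationOn Q (F + F') where
  map_bot h := by simp [hF.map_bot h, hF'.map_bot h]
  map_sup_add_map_inf a b h := by
    simp only [Pi.add_apply]
    rw [add_add_add_comm, hF.map_sup_add_map_inf a b h, hF'.map_sup_add_map_inf a b h,
      add_add_add_comm]

lemma neg (hF : IsValuationOn Q F) : IsValuationOn Q (-F) where
  map_bot h := by simp [hF.map_bot h]
  map_sup_add_map_inf a b h := by
    simp only [Pi.neg_apply, ← neg_add, hF.map_sup_add_map_inf a b h]

lemma comp (hf : IsValuationOn Q f) {φ : β → α} (mem : ∀ b, φ b ∈ Q) (map_bot : φ ⊥ = ⊥)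
    (map_sup : ∀ a b, φ (a ⊔ b) = φ a ⊔ φ b) (map_inf : ∀ a b, φ (a ⊓ b) = φ a ⊓ φ b) :
    IsValuationOn ⊤ (f ∘ φ) where
  map_bot _ := by rw [Function.comp_apply, map_bot, hf.map_bot (map_bot ▸ mem ⊥)]
  map_sup_add_map_inf a b _ := by
    simp only [Function.comp_apply, map_sup, map_inf]
    exact hf.map_sup_add_map_inf _ _ (map_sup a b ▸ mem (a ⊔ b))

lemma comp_inf_right (hf : IsValuationOn Q f) {a : α} (ha : a ∈ Q) :
    IsValuationOn ⊤ fun b ↦ f (b ⊓ a) :=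
  hf.comp (fun _ ↦ Q.lower inf_le_right ha) (bot_inf_eq a) (fun _ _ ↦ inf_sup_right ..)
    fun _ _ ↦ inf_inf_distrib_right ..

lemma map_of_le_sup (hf : IsValuationOn Q f) {a b c : α} (hc : c ∈ Q) (h : c ≤ a ⊔ b) :
    f c = f (c ⊓ b) + f (c ⊓ a) - f (c ⊓ (a ⊓ b)) := by
  have hsup : (c ⊓ a) ⊔ (c ⊓ b) = c := by rw [← inf_sup_left, inf_eq_left.mpr h]
  have := hf.map_sup_add_map_inf (c ⊓ a) (c ⊓ b) (hsup.symm ▸ hc)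
  rw [hsup, ← inf_inf_distrib_left] at this
  rw [add_comm, ← this, add_sub_cancel_right]

theorem exists_extension (hf : IsValuationOn Q f) (s : Finset α) (hs : ∀ a ∈ s, a ∈ Q) :
    ∃ F : α → G, IsValuationOn ⊤ F ∧ ∀ a ∈ Q, a ≤ s.sup id → F a = f a := by
  classical
  induction s using Finset.induction_on with
  | empty =>
    refine ⟨0, ⟨by simp, by simp⟩, fun a ha hle ↦ ?_⟩
    obtain rfl : a = ⊥ := le_bot_iff.mp (by simpa using hle)
    exact (hf.map_bot ha).symm
  | insert a t _ ih =>
    obtain ⟨F, hF, hFf⟩ := ih fun b hb ↦ hs b (Finset.mem_insert_of_mem hb)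
    have ha : a ∈ Q := hs a (Finset.mem_insert_self a t)
    have hat : a ⊓ t.sup id ∈ Q := Q.lower inf_le_left ha
    -- Inclusion–exclusion dictates the value on elements below `a ⊔ t.sup id`.
    refine ⟨_, ((hF.comp_inf_right (a := t.sup id) trivial).add (hf.comp_inf_right ha)).add
      (hf.comp_inf_right hat).neg, fun b hb hle ↦ ?_⟩
    rw [Finset.sup_insert] at hle
    simp only [Pi.add_apply, Pi.neg_apply, hFf _ (Q.lower inf_le_left hb) inf_le_right]
    rw [← sub_eq_add_neg]
    exact (hf.map_of_le_sup hb hle).symm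

theorem eq_of_le_sup (hF : IsValuationOn ⊤ F) (hF' : IsValuationOn ⊤ F')
    (h : ∀ a ∈ Q, F a = F' a) (s : Finset α) (hs : ∀ a ∈ s, a ∈ Q) :
    ∀ a ≤ s.sup id, F a = F' a := by
  classical
  induction s using Finset.induction_on with
  | empty =>
    intro a ha
    obtain rfl : a = ⊥ := le_bot_iff.mp (by simpa using ha)
    rw [hF.map_bot trivial, hF'.map_bot trivial]
  | insert b t _ ih =>
    intro a ha
    have ih := ih fun c hc ↦ hs c (Finset.mem_insert_of_mem hc)
    have hb : b ∈ Q := hs b (Finset.mem_insert_self b t)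
    rw [Finset.sup_insert, id_eq] at ha
    rw [hF.map_of_le_sup trivial ha, hF'.map_of_le_sup trivial ha, ih _ inf_le_right,
      h _ (Q.lower inf_le_right hb), h _ (Q.lower (inf_le_right.trans inf_le_left) hb)]

end IsValuationOn

end Valuation

section ClosedSubset

variable {Y : Scheme.{u}}

/-- The closed immersion of a closed subset with its reduced structure. -/
noncomputable def reducedι (C : Closeds Y) :
    (Scheme.IdealSheafData.vanishingIdeal C).subscheme ⟶ Y :=
  (Scheme.IdealSheafData.vanishingIdeal C).subschemeι

instance (C : Closeds Y) : IsClosedImmersion (reducedι C) := by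
  unfold reducedι; infer_instance

@[simp]
lemma range_reducedι (C : Closeds Y) : Set.range (reducedι C) = C := by
  rw [reducedι, Scheme.IdealSheafData.range_subschemeι,
    Scheme.IdealSheafData.coe_support_vanishingIdeal]

instance (C : Closeds Y) : IsReduced (Scheme.IdealSheafData.vanishingIdeal C).subscheme := by
  let 𝒰 := (Scheme.IdealSheafData.vanishingIdeal C).subschemeCover.openCover
  have (V : 𝒰.I₀) : IsReduced (𝒰.X V) := by
    let V : Y.affineOpens := V
    have : _root_.IsReduced (Γ(Y, V) ⧸ (Scheme.IdealSheafData.vanishingIdeal C).ideal V) := by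
      rw [Scheme.IdealSheafData.vanishingIdeal_ideal]
      exact (Ideal.isRadical_iff_quotient_reduced _).mp
        (PrimeSpectrum.isRadical_vanishingIdeal _)
    exact inferInstanceAs (IsReduced (Spec (.of (Γ(Y, V) ⧸
      (Scheme.IdealSheafData.vanishingIdeal C).ideal V))))
  exact IsReduced.of_openCover _ 𝒰

end ClosedSubset

section Range

lemma range_morphismRestrict {T Y : Scheme.{u}} (t : T ⟶ Y) (W : Y.Opens) :
    Set.range (t ∣_ W) = W.ι ⁻¹' Set.range t := by
  rw [morphismRestrict_base]
  exact Set.range_restrictPreimage ..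

lemma isCompl_range_morphismRestrict {Z U Y : Scheme.{u}} {i : Z ⟶ Y} {j : U ⟶ Y}
    (hij : IsCompl (Set.range i) (Set.range j)) (W : Y.Opens) :
    IsCompl (Set.range (i ∣_ W)) (Set.range (j ∣_ W)) := by
  rw [range_morphismRestrict, range_morphismRestrict]
  exact hij.preimage W.ι

lemma range_fst_of_isPullback {P S T Y : Scheme.{u}} {fst : P ⟶ S} {snd : P ⟶ T} {f : S ⟶ Y}
    {g : T ⟶ Y} (h : IsPullback fst snd f g) : Set.range fst = f ⁻¹' Set.range g := by
  simpa using Scheme.image_preimage_eq_of_isPullback h.flip Set.univ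

end Range

section AdditiveInvariant

variable {X : Scheme.{u}} {G : Type*} [AddCommGroup G]
  {Q : ∀ ⦃Y : Scheme.{u}⦄, (Y ⟶ X) → Prop} {c c' : ∀ ⦃Y : Scheme.{u}⦄, (Y ⟶ X) → G}

/-- A property of schemes over `X` that passes to locally closed subschemes. -/
structure IsStable (Q : ∀ ⦃Y : Scheme.{u}⦄, (Y ⟶ X) → Prop) : Prop where
  comp : ∀ ⦃Z Y : Scheme.{u}⦄ (i : Z ⟶ Y) [IsImmersion i] (g : Y ⟶ X), Q g → Q (i ≫ g)

/-- An invariant `c` of schemes over `X` that is additive on the schemes satisfying `Q`. The closed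
and the open part of a scheme are given by immersions with complementary ranges. -/
structure IsAdditiveOn (Q : ∀ ⦃Y : Scheme.{u}⦄, (Y ⟶ X) → Prop)
    (c : ∀ ⦃Y : Scheme.{u}⦄, (Y ⟶ X) → G) : Prop where
  add : ∀ ⦃Z U Y : Scheme.{u}⦄ (i : Z ⟶ Y) (j : U ⟶ Y) (g : Y ⟶ X) [IsClosedImmersion i]
    [IsOpenImmersion j], Q g → IsCompl (Set.range i) (Set.range j) →
    c g = c (i ≫ g) + c (j ≫ g)

lemma IsStable.homOfLE (hQ : IsStable Q) {Y : Scheme.{u}} {g : Y ⟶ X} {V W : Y.Opens}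
    (hVW : V ≤ W) (hW : Q (W.ι ≫ g)) : Q (V.ι ≫ g) := by
  rw [← Y.homOfLE_ι hVW, Category.assoc]
  exact hQ.comp _ _ hW

/-- The open subschemes satisfying a stable property. -/
def IsStable.opens (hQ : IsStable Q) {Y : Scheme.{u}} (g : Y ⟶ X) : LowerSet Y.Opens where
  carrier := {V | Q (V.ι ≫ g)}
  lower' _ _ hVW hW := hQ.homOfLE hVW hW

/-- A finite cover by open subschemes satisfying `Q`. -/
def HasFiniteOpenCover (Q : ∀ ⦃Y : Scheme.{u}⦄, (Y ⟶ X) → Prop) ⦃Y : Scheme.{u}⦄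
    (g : Y ⟶ X) : Prop :=
  ∃ s : Finset Y.Opens, (∀ V ∈ s, Q (V.ι ≫ g)) ∧ s.sup id = ⊤

namespace IsStable

lemma comp_preimage (hQ : IsStable Q) {Y Y' : Scheme.{u}} {g : Y ⟶ X} (i : Y' ⟶ Y)
    [IsImmersion i] {V : Y.Opens} (hV : Q (V.ι ≫ g)) : Q ((i ⁻¹ᵁ V).ι ≫ i ≫ g) := by
  rw [← morphismRestrict_ι_assoc]
  have : IsImmersion (i ∣_ V) :=
    MorphismProperty.of_isPullback (isPullback_morphismRestrict i V).flip ‹_›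
  exact hQ.comp _ _ hV

lemma hasFiniteOpenCover (hQ : IsStable Q) {Y : Scheme.{u}} {g : Y ⟶ X} (hg : Q g) :
    HasFiniteOpenCover Q g :=
  ⟨{⊤}, by simpa using hQ.comp _ g hg, by simp⟩

lemma isStable_hasFiniteOpenCover (hQ : IsStable Q) : IsStable (HasFiniteOpenCover Q) where
  comp Y' Y i _ g := by
    classical
    rintro ⟨s, hs, htop⟩
    refine ⟨s.image (i ⁻¹ᵁ ·), ?_, ?_⟩
    · simpa using fun V hV ↦ hQ.comp_preimage i (hs V hV)
    · rw [Finset.sup_image, Function.id_comp]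
      exact (map_finset_sup (Opens.comap i.base.hom) s id).symm.trans
        (congrArg (i ⁻¹ᵁ ·) htop)

end IsStable

lemma IsValuationOn.comp_opensMap {Z Y : Scheme.{u}} {F : Z.Opens → G}
    (hF : IsValuationOn ⊤ F) (i : Z ⟶ Y) : IsValuationOn ⊤ fun V ↦ F (i ⁻¹ᵁ V) :=
  hF.comp (fun _ ↦ trivial) rfl (fun _ _ ↦ rfl) fun _ _ ↦ rfl

namespace IsAdditiveOn

lemma mono {R : ∀ ⦃Y : Scheme.{u}⦄, (Y ⟶ X) → Prop} (hc : IsAdditiveOn Q c)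
    (h : ∀ ⦃Y : Scheme.{u}⦄ (g : Y ⟶ X), R g → Q g) : IsAdditiveOn R c where
  add _ _ _ i j g _ _ hg hij := hc.add i j g (h g hg) hij

lemma map {H : Type*} [AddCommGroup H] (hc : IsAdditiveOn Q c) (φ : G →+ H) :
    IsAdditiveOn Q fun _ g ↦ φ (c g) where
  add _ _ _ i j g _ _ hg hij := by rw [hc.add i j g hg hij, map_add]

lemma of_isEmpty (hc : IsAdditiveOn Q c) {Y : Scheme.{u}} [IsEmpty Y] (g : Y ⟶ X) (hg : Q g) :
    c g = 0 := by
  have := hc.add (𝟙 Y) (𝟙 Y) g hg (by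
    rw [Set.range_eq_empty, isCompl_iff, disjoint_self, codisjoint_self]
    exact ⟨rfl, Subsingleton.elim _ _⟩)
  simpa using this

lemma of_isIso (hQ : IsStable Q) (hc : IsAdditiveOn Q c) {Y Y' : Scheme.{u}} (e : Y' ⟶ Y)
    [IsIso e] (g : Y ⟶ X) (hg : Q g) : c (e ≫ g) = c g := by
  have := hc.add (initial.to Y) e g hg (by
    rw [Set.range_eq_empty, Set.range_eq_univ.mpr e.surjective]
    exact isCompl_bot_top)
  rw [this, hc.of_isEmpty _ (hQ.comp (initial.to Y) g hg), zero_add]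

lemma of_range_eq (hQ : IsStable Q) (hc : IsAdditiveOn Q c) {U V Y : Scheme.{u}} (a : U ⟶ Y)
    (b : V ⟶ Y) [IsOpenImmersion a] [IsOpenImmersion b] (hab : Set.range a = Set.range b)
    (g : Y ⟶ X) (hg : Q (b ≫ g)) : c (a ≫ g) = c (b ≫ g) := by
  rw [← hc.of_isIso hQ (IsOpenImmersion.isoOfRangeEq a b hab).hom _ hg,
    IsOpenImmersion.isoOfRangeEq_hom_fac_assoc]

lemma add_opens (hc : IsAdditiveOn Q c) {Z U Y : Scheme.{u}} {i : Z ⟶ Y} {j : U ⟶ Y}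
    {g : Y ⟶ X} [IsClosedImmersion i] [IsOpenImmersion j]
    (hij : IsCompl (Set.range i) (Set.range j)) {W : Y.Opens} (hW : Q (W.ι ≫ g)) :
    c (W.ι ≫ g) = c ((i ⁻¹ᵁ W).ι ≫ i ≫ g) + c ((j ⁻¹ᵁ W).ι ≫ j ≫ g) := by
  rw [hc.add (i ∣_ W) (j ∣_ W) (W.ι ≫ g) hW (isCompl_range_morphismRestrict hij W),
    morphismRestrict_ι_assoc, morphismRestrict_ι_assoc]

lemma add_inf (hQ : IsStable Q) (hc : IsAdditiveOn Q c) {Z Y : Scheme.{u}} {i : Z ⟶ Y}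
    {g : Y ⟶ X} [IsClosedImmersion i] {V W : Y.Opens} (hiV : IsCompl (Set.range i) (V : Set Y))
    (hW : Q (W.ι ≫ g)) : c (W.ι ≫ g) = c ((i ⁻¹ᵁ W).ι ≫ i ≫ g) + c ((V ⊓ W).ι ≫ g) := by
  rw [hc.add_opens (i := i) (j := V.ι) (by rwa [Scheme.Opens.range_ι]) hW]
  congr 1
  rw [← Category.assoc]
  refine hc.of_range_eq hQ _ _ ?_ g (hQ.homOfLE inf_le_right hW)
  simp [Set.range_comp, Set.image_preimage_eq_range_inter]

lemma isValuationOn_opens (hQ : IsStable Q) (hc : IsAdditiveOn Q c) {Y : Scheme.{u}}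
    (g : Y ⟶ X) : IsValuationOn (hQ.opens g) fun V ↦ c (V.ι ≫ g) where
  map_bot hbot :=
    have : IsEmpty (⊥ : Y.Opens) := ⟨fun x ↦ x.2⟩
    hc.of_isEmpty _ hbot
  map_sup_add_map_inf V W hVW := by
    -- `V ⊔ W` and `W` have the same closed part outside `V`.
    have hV : IsCompl (Set.range (reducedι V.compl)) (V : Set Y) := by
      simpa using isCompl_compl.symm
    have hpre : reducedι V.compl ⁻¹ᵁ (V ⊔ W) = reducedι V.compl ⁻¹ᵁ W := by
      ext x
      exact or_iff_right (hV.disjoint.notMem_of_mem_left ⟨x, rfl⟩)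
    have hsup := hc.add_inf hQ hV hVW
    have hinf := hc.add_inf hQ hV (hQ.homOfLE le_sup_right hVW)
    rw [inf_eq_left.mpr (le_sup_left : V ≤ V ⊔ W), hpre] at hsup
    simp only [hsup, hinf]
    abel

theorem exists_extension (hQ : IsStable Q) (hc : IsAdditiveOn Q c) :
    ∃ c' : ∀ ⦃Y : Scheme.{u}⦄, (Y ⟶ X) → G, IsAdditiveOn (HasFiniteOpenCover Q) c' ∧
      ∀ ⦃Y : Scheme.{u}⦄ (g : Y ⟶ X), Q g → c' g = c g := by
  have hval ⦃Y : Scheme.{u}⦄ (g : Y ⟶ X) : ∃ F : Y.Opens → G, HasFiniteOpenCover Q g →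
      IsValuationOn ⊤ F ∧ ∀ V : Y.Opens, Q (V.ι ≫ g) → F V = c (V.ι ≫ g) := by
    by_cases hg : HasFiniteOpenCover Q g
    · obtain ⟨s, hs, htop⟩ := hg
      obtain ⟨F, hF, hFc⟩ := (hc.isValuationOn_opens hQ g).exists_extension s hs
      exact ⟨F, fun _ ↦ ⟨hF, fun V hV ↦ hFc V hV (htop ▸ le_top)⟩⟩
    · exact ⟨0, fun h ↦ absurd h hg⟩
  choose F hF using hval
  have hR := hQ.isStable_hasFiniteOpenCover
  refine ⟨fun Y g ↦ F g ⊤, ⟨fun Z U Y i j g _ _ hg hij ↦ ?_⟩, fun Y g hg ↦ ?_⟩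
  · have hi := hF (i ≫ g) (hR.comp i g hg)
    have hj := hF (j ≫ g) (hR.comp j g hg)
    have hadd (V : Y.Opens) (hV : Q (V.ι ≫ g)) :
        F g V = F (i ≫ g) (i ⁻¹ᵁ V) + F (j ≫ g) (j ⁻¹ᵁ V) := by
      rw [(hF g hg).2 V hV, hi.2 _ (hQ.comp_preimage i hV), hj.2 _ (hQ.comp_preimage j hV)]
      exact hc.add_opens hij hV
    obtain ⟨s, hs, htop⟩ := id hg
    exact (hF g hg).1.eq_of_le_sup ((hi.1.comp_opensMap i).add (hj.1.comp_opensMap j))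
      (Q := hQ.opens g) hadd s hs ⊤ htop.ge
  · have hcover : HasFiniteOpenCover Q g := hQ.hasFiniteOpenCover hg
    exact ((hF g hcover).2 ⊤ (hQ.comp _ g hg)).trans (hc.of_isIso hQ Y.topIso.hom g hg)

theorem eq_of_hasFiniteOpenCover {R : ∀ ⦃Y : Scheme.{u}⦄, (Y ⟶ X) → Prop} (hQ : IsStable Q)
    (hR : IsStable R) (hc : IsAdditiveOn R c) (hc' : IsAdditiveOn R c') {Y : Scheme.{u}}
    {g : Y ⟶ X} (h : ∀ V : Y.Opens, Q (V.ι ≫ g) → c (V.ι ≫ g) = c' (V.ι ≫ g)) (hg : R g)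
    (hcover : HasFiniteOpenCover Q g) : c g = c' g := by
  have hle : (⊤ : LowerSet Y.Opens) ≤ hR.opens g := fun V _ ↦ hR.comp V.ι g hg
  have hval := (hc.isValuationOn_opens hR g).mono hle
  have hval' := (hc'.isValuationOn_opens hR g).mono hle
  obtain ⟨s, hs, htop⟩ := hcover
  calc c g = c ((⊤ : Y.Opens).ι ≫ g) := (hc.of_isIso hR Y.topIso.hom g hg).symm
    _ = c' ((⊤ : Y.Opens).ι ≫ g) :=
      hval.eq_of_le_sup hval' (Q := hQ.opens g) h s hs ⊤ htop.ge
    _ = c' g := hc'.of_isIso hR Y.topIso.hom g hg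

lemma sub_eq_sub_of_isPullback (hQ : IsStable Q) (hc : IsAdditiveOn Q c)
    {Y Y' Z Z' : Scheme.{u}} {i' : Z' ⟶ Y'} {q' : Z' ⟶ Z} {q : Y' ⟶ Y} {i : Z ⟶ Y}
    [IsClosedImmersion i] (hpb : IsPullback i' q' q i) (hiso : IsIso (q ∣_ complement i))
    (g : Y ⟶ X) (hg : Q g) (hqg : Q (q ≫ g)) :
    c (q ≫ g) - c (i' ≫ q ≫ g) = c g - c (i ≫ g) := by
  have : IsClosedImmersion i' := MorphismProperty.of_isPullback hpb.flip ‹_›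
  have hcompl : IsCompl (Set.range i) (complement i : Set Y) := isCompl_compl
  have hcompl' : IsCompl (Set.range i') (q ⁻¹ᵁ complement i : Set Y') := by
    rw [range_fst_of_isPullback hpb]
    exact hcompl.preimage q
  have hopen : c ((q ⁻¹ᵁ complement i).ι ≫ q ≫ g) = c ((complement i).ι ≫ g) := by
    rw [← morphismRestrict_ι_assoc]
    exact hc.of_isIso hQ _ _ (hQ.comp _ g hg)
  rw [hc.add i (complement i).ι g hg (by rwa [Scheme.Opens.range_ι]),
    hc.add i' (q ⁻¹ᵁ complement i).ι (q ≫ g) hqg (by rwa [Scheme.Opens.range_ι]), hopen,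
    add_sub_cancel_left, add_sub_cancel_left]

end IsAdditiveOn

end AdditiveInvariant

section AcyclicInvariant

variable {X : Scheme.{u}} {G : Type*} [AddCommGroup G] {b : ∀ ⦃Y : Scheme.{u}⦄, (Y ⟶ X) → G}

/-- An invariant `b` of schemes over `X` that satisfies the acyclicity relations on the proper
ones. Its values on schemes that are not proper over `X` are irrelevant. -/
structure IsAcyclic (b : ∀ ⦃Y : Scheme.{u}⦄, (Y ⟶ X) → G) : Prop where
  of_isEmpty : ∀ ⦃Y : Scheme.{u}⦄ [IsEmpty Y] (f : Y ⟶ X), b f = 0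
  sub_eq_sub : ∀ ⦃Y Y' Z : Scheme.{u}⦄ (f : Y ⟶ X) (q : Y' ⟶ Y) (i : Z ⟶ Y) [IsProper f]
    [IsProper q] [IsClosedImmersion i], IsIso (q ∣_ complement i) →
    b (q ≫ f) - b (pullback.fst q i ≫ q ≫ f) = b f - b (i ≫ f)

/-- The value of an invariant on a closed subset of `Y`, given its reduced structure. -/
noncomputable def closedValue (b : ∀ ⦃Y : Scheme.{u}⦄, (Y ⟶ X) → G) {Y : Scheme.{u}} (f : Y ⟶ X)
    (C : Closeds Y) : G :=
  b (reducedι C ≫ f)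

namespace IsAcyclic

variable (hb : IsAcyclic b) {Y : Scheme.{u}} (f : Y ⟶ X) [IsProper f]
include hb

-- This is the square with the empty modification: the complement of the image is empty.
lemma comp_of_surjective {Z : Scheme.{u}} (i : Z ⟶ Y) [IsClosedImmersion i] [Surjective i] :
    b (i ≫ f) = b f := by
  have : IsEmpty (complement i) := ⟨fun x ↦ x.2 (i.surjective x.1)⟩
  have : IsEmpty (pullback (initial.to Y) i : Scheme.{u}) :=
    (pullback.fst (initial.to Y) i).base.hom.1.isEmpty
  have h := hb.sub_eq_sub f (initial.to Y) i (isIso_of_isEmpty _)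
  rw [hb.of_isEmpty, hb.of_isEmpty, sub_zero, eq_comm, sub_eq_zero] at h
  exact h.symm

lemma comp_eq_of_range_eq {Z Z' : Scheme.{u}} (i : Z ⟶ Y) (i' : Z' ⟶ Y) [IsClosedImmersion i]
    [IsClosedImmersion i'] (h : Set.range i = Set.range i') : b (i ≫ f) = b (i' ≫ f) := by
  have : Surjective (pullback.fst i i') := by
    rw [surjective_iff, ← Set.range_eq_univ, Scheme.Pullback.range_fst, ← h, Set.preimage_range]
  have : Surjective (pullback.snd i i') := by
    rw [surjective_iff, ← Set.range_eq_univ, Scheme.Pullback.range_snd, h, Set.preimage_range]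
  rw [← hb.comp_of_surjective (i ≫ f) (pullback.fst i i'),
    ← hb.comp_of_surjective (i' ≫ f) (pullback.snd i i'), pullback.condition_assoc]

lemma comp_eq_closedValue {Z : Scheme.{u}} (i : Z ⟶ Y) [IsClosedImmersion i] {C : Closeds Y}
    (h : Set.range i = C) : b (i ≫ f) = closedValue b f C :=
  hb.comp_eq_of_range_eq f i (reducedι C) (h.trans (range_reducedι C).symm)

lemma closedValue_bot : closedValue b f ⊥ = 0 := by
  rw [← hb.comp_eq_closedValue f (initial.to Y) (Set.range_eq_empty _), hb.of_isEmpty]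

lemma closedValue_comp {Z : Scheme.{u}} (i : Z ⟶ Y) [IsClosedImmersion i] {C : Closeds Z}
    {D : Closeds Y} (h : i '' C = D) : closedValue b (i ≫ f) C = closedValue b f D := by
  rw [closedValue, ← Category.assoc]
  exact hb.comp_eq_closedValue f _ (by rw [Scheme.Hom.comp_base, TopCat.coe_comp, Set.range_comp,
    range_reducedι, h])

lemma sub_closedValue {Y' : Scheme.{u}} (q : Y' ⟶ Y) [IsProper q] (C : Closeds Y)
    (h : IsIso (q ∣_ C.compl)) :
    b (q ≫ f) - closedValue b (q ≫ f) (C.preimage q.continuous) = b f - closedValue b f C := by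
  have hC : complement (reducedι C) = C.compl := by
    ext x
    simp [complement]
  rw [← hb.comp_eq_closedValue (q ≫ f) (pullback.fst q (reducedι C)) (by
    rw [Scheme.Pullback.range_fst, range_reducedι]
    rfl)]
  exact hb.sub_eq_sub f q (reducedι C) (hC ▸ h)

-- The inclusion of `D` is an isomorphism away from `C`.
lemma closedValue_add_of_sup_eq_top [IsReduced Y] {C D : Closeds Y} (h : C ⊔ D = ⊤) :
    b f + closedValue b f (C ⊓ D) = closedValue b f C + closedValue b f D := by
  have : Surjective (reducedι D ∣_ C.compl) := by
    rw [surjective_iff, ← Set.range_eq_univ, range_morphismRestrict, range_reducedι,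
      Set.eq_univ_iff_forall]
    exact fun x ↦ (h.ge (trivial : x.1 ∈ (⊤ : Closeds Y))).resolve_left x.2
  have hsub := hb.sub_closedValue f (reducedι D) C (isIso_of_isClosedImmersion_of_surjective _)
  rw [hb.closedValue_comp f (reducedι D) (D := C ⊓ D) (by
    simp [Set.image_preimage_eq_inter_range])] at hsub
  rw [add_comm (closedValue b f C)]
  exact (sub_eq_sub_iff_add_eq_add.mp hsub).symm

lemma isValuationOn_closedValue : IsValuationOn ⊤ (closedValue b f) where
  map_bot _ := hb.closedValue_bot f
  map_sup_add_map_inf C D _ := by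
    obtain ⟨Z, i, _, _, hi⟩ : ∃ (Z : Scheme.{u}) (i : Z ⟶ Y), IsClosedImmersion i ∧
        IsReduced Z ∧ Set.range i = (C ⊔ D : Closeds Y) :=
      ⟨_, reducedι (C ⊔ D), inferInstance, inferInstance, range_reducedι _⟩
    have hpre (E : Closeds Y) (hE : E ≤ C ⊔ D) :
        closedValue b (i ≫ f) (E.preimage i.continuous) = closedValue b f E :=
      hb.closedValue_comp f i (by
        rw [Closeds.coe_preimage, Set.image_preimage_eq_inter_range, hi]
        exact Set.inter_eq_left.mpr hE)
    rw [← hb.comp_eq_closedValue f i hi, ← hpre C le_sup_left, ← hpre D le_sup_right,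
      ← hpre (C ⊓ D) (inf_le_left.trans le_sup_left),
      show (C ⊓ D).preimage i.continuous = C.preimage i.continuous ⊓ D.preimage i.continuous from
        SetLike.coe_injective rfl]
    refine hb.closedValue_add_of_sup_eq_top (i ≫ f) (SetLike.coe_injective ?_)
    rw [Closeds.coe_sup] at hi
    simp [← Set.preimage_union, ← hi]

end IsAcyclic

end AcyclicInvariant

section Compactification

variable {X : Scheme.{u}}

-- The induced map to the fibre product is an open immersion with closed and dense image.
theorem isPullback_of_isDominant {Z Y P P' : Scheme.{u}} {j' : Z ⟶ P'} {i : Z ⟶ Y} {q : P' ⟶ P}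
    {j : Y ⟶ P} [IsOpenImmersion j'] [IsDominant j'] [UniversallyClosed i] [IsSeparated q]
    [IsOpenImmersion j] (h : j' ≫ q = i ≫ j) : IsPullback j' i q j := by
  let s : Z ⟶ pullback q j := pullback.lift j' i h
  have hfst : s ≫ pullback.fst q j = j' := pullback.lift_fst _ _ _
  have hsnd : s ≫ pullback.snd q j = i := pullback.lift_snd _ _ _
  have : IsOpenImmersion (s ≫ pullback.fst q j) := hfst ▸ ‹_›
  have : IsDominant (s ≫ pullback.fst q j) := hfst ▸ ‹_›
  have : UniversallyClosed (s ≫ pullback.snd q j) := hsnd ▸ ‹_›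
  have : IsOpenImmersion s := .of_comp s (pullback.fst q j)
  have : UniversallyClosed s := .of_comp_of_isSeparated s (pullback.snd q j)
  have : IsDominant s := .of_comp_of_isOpenImmersion s (pullback.fst q j)
  have : Surjective s := surjective_of_isDominant_of_isClosed_range s s.isClosedMap.isClosed_range
  have : IsIso s := IsOpenImmersion.isIso s
  exact .of_iso_pullback ⟨h⟩ (asIso s) hfst hsnd

/-- The boundary of an open subscheme `j : Y ⟶ P`. -/
def boundary {Y P : Scheme.{u}} (j : Y ⟶ P) [IsOpenImmersion j] : Closeds P :=
  j.opensRange.compl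

lemma preimage_boundary {Z Y P P' : Scheme.{u}} {j' : Z ⟶ P'} {i : Z ⟶ Y} {q : P' ⟶ P}
    {j : Y ⟶ P} [IsOpenImmersion j'] [IsOpenImmersion j] (h : IsPullback j' i q j) :
    (boundary j).preimage q.continuous = boundary j' :=
  SetLike.coe_injective (congrArg compl (range_fst_of_isPullback h)).symm

lemma isIso_morphismRestrict_boundary {Y P P' : Scheme.{u}} {j' : Y ⟶ P'} {q : P' ⟶ P}
    {j : Y ⟶ P} [IsOpenImmersion j] (h : IsPullback j' (𝟙 Y) q j) :
    IsIso (q ∣_ (boundary j).compl) := by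
  have : IsIso (pullback.snd q j) := h.isoPullback_inv_snd ▸ inferInstance
  rw [boundary, Opens.compl_compl]
  exact ((MorphismProperty.isomorphisms Scheme).arrow_mk_iso_iff
    (morphismRestrictOpensRange q j)).mpr this

lemma boundary_comp {Z U Y P D : Scheme.{u}} {j' : Z ⟶ D} {i : Z ⟶ Y} {d : D ⟶ P}
    {j : Y ⟶ P} {v : U ⟶ Y} [IsOpenImmersion j] [IsOpenImmersion v]
    (h : IsPullback j' i d j) (hiv : IsCompl (Set.range i) (Set.range v)) :
    (boundary (v ≫ j) : Set P) = Set.range d ∪ boundary j := by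
  have hi : j '' Set.range i = Set.range d ∩ Set.range j := by
    rw [range_fst_of_isPullback h.flip, Set.image_preimage_eq_inter_range]
  have hv : j '' Set.range v = Set.range j \ Set.range d := by
    rw [← hiv.compl_eq, Set.image_compl_eq_range_sdiff_image j.isOpenEmbedding.injective, hi,
      Set.sdiff_inter_self_eq_sdiff]
  change (Set.range (v ≫ j))ᶜ = Set.range d ∪ (Set.range j)ᶜ
  rw [Scheme.Hom.comp_base, TopCat.coe_comp, Set.range_comp, hv, Set.compl_sdiff]

/-- A scheme over `X` that is open in a scheme proper over `X`. -/
def IsCompactifiable ⦃Y : Scheme.{u}⦄ (g : Y ⟶ X) : Prop :=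
  ∃ (P : Scheme.{u}) (f : P ⟶ X) (j : Y ⟶ P), IsProper f ∧ IsOpenImmersion j ∧ j ≫ f = g

lemma isCompactifiable_of_isOpenImmersion {Y P : Scheme.{u}} (j : Y ⟶ P) (f : P ⟶ X)
    [IsOpenImmersion j] [IsProper f] : IsCompactifiable (j ≫ f) :=
  ⟨P, f, j, ‹_›, ‹_›, rfl⟩

lemma isCompactifiable_of_isImmersion {Z P : Scheme.{u}} (l : Z ⟶ P) (f : P ⟶ X)
    [IsImmersion l] [QuasiCompact l] [IsProper f] : IsCompactifiable (l ≫ f) := by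
  rw [← l.toImage_imageι, Category.assoc]
  exact isCompactifiable_of_isOpenImmersion l.toImage (l.imageι ≫ f)

/-- The value that an invariant of proper schemes over `X` assigns to an open subscheme. -/
noncomputable def openValue {G : Type*} [AddCommGroup G]
    (b : ∀ ⦃Y : Scheme.{u}⦄, (Y ⟶ X) → G) {Y P : Scheme.{u}} (f : P ⟶ X) (j : Y ⟶ P)
    [IsOpenImmersion j] : G :=
  b f - closedValue b f (boundary j)

lemma quasiCompact_of_isImmersion {Z P : Scheme.{u}} [IsLocallyNoetherian P] (l : Z ⟶ P)
    [IsImmersion l] : QuasiCompact l := by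
  rw [← l.liftCoborder_ι]
  infer_instance

lemma quasiCompact_of_comp_isProper [IsLocallyNoetherian X] {Z P : Scheme.{u}} (l : Z ⟶ P)
    (f : P ⟶ X) [IsImmersion l] [IsProper f] : QuasiCompact l :=
  have := LocallyOfFiniteType.isLocallyNoetherian f
  quasiCompact_of_isImmersion l

lemma isStable_isCompactifiable [IsLocallyNoetherian X] :
    IsStable (IsCompactifiable (X := X)) where
  comp Z Y i _ g := by
    rintro ⟨P, f, j, _, _, rfl⟩
    have := quasiCompact_of_comp_isProper (i ≫ j) f
    rw [← Category.assoc]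
    exact isCompactifiable_of_isImmersion (i ≫ j) f

namespace IsAcyclic

variable {G : Type*} [AddCommGroup G] {b : ∀ ⦃Y : Scheme.{u}⦄, (Y ⟶ X) → G} (hb : IsAcyclic b)
include hb

lemma openValue_comp {Y P P' : Scheme.{u}} (f : P ⟶ X) [IsProper f] (q : P' ⟶ P) [IsProper q]
    (j : Y ⟶ P) (j' : Y ⟶ P') [IsOpenImmersion j] [IsOpenImmersion j'] [IsDominant j']
    (h : j' ≫ q = j) : openValue b (q ≫ f) j' = openValue b f j := by
  have hpb : IsPullback j' (𝟙 Y) q j := isPullback_of_isDominant (by rwa [Category.id_comp])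
  rw [openValue, ← preimage_boundary hpb]
  exact hb.sub_closedValue f q (boundary j) (isIso_morphismRestrict_boundary hpb)

lemma openValue_id {P : Scheme.{u}} (f : P ⟶ X) [IsProper f] : openValue b f (𝟙 P) = b f := by
  have : boundary (𝟙 P) = ⊥ := SetLike.coe_injective <| by
    change (Set.range (𝟙 P : P ⟶ P))ᶜ = ∅
    rw [Set.range_eq_univ.mpr (𝟙 P : P ⟶ P).surjective, Set.compl_univ]
  rw [openValue, this, hb.closedValue_bot, sub_zero]

-- Both compactifications are dominated by the closure of `Y` in their fibre product.
theorem openValue_eq [IsLocallyNoetherian X] {Y P₁ P₂ : Scheme.{u}} (f₁ : P₁ ⟶ X) (f₂ : P₂ ⟶ X)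
    [IsProper f₁] [IsProper f₂] (j₁ : Y ⟶ P₁) (j₂ : Y ⟶ P₂) [IsOpenImmersion j₁]
    [IsOpenImmersion j₂] (h : j₁ ≫ f₁ = j₂ ≫ f₂) : openValue b f₁ j₁ = openValue b f₂ j₂ := by
  let l : Y ⟶ pullback f₁ f₂ := pullback.lift j₁ j₂ h
  have hfst : l ≫ pullback.fst f₁ f₂ = j₁ := pullback.lift_fst _ _ _
  have hsnd : l ≫ pullback.snd f₁ f₂ = j₂ := pullback.lift_snd _ _ _
  have : IsImmersion (l ≫ pullback.fst f₁ f₂) := hfst ▸ inferInstance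
  have : IsImmersion l := .of_comp l (pullback.fst f₁ f₂)
  have := quasiCompact_of_comp_isProper l (pullback.fst f₁ f₂ ≫ f₁)
  rw [← hb.openValue_comp f₁ (l.imageι ≫ pullback.fst f₁ f₂) j₁ l.toImage (by simp [hfst]),
    ← hb.openValue_comp f₂ (l.imageι ≫ pullback.snd f₁ f₂) j₂ l.toImage (by simp [hsnd])]
  simp only [Category.assoc, pullback.condition]

lemma openValue_add {Z U Y P : Scheme.{u}} (i : Z ⟶ Y) (v : U ⟶ Y) (j : Y ⟶ P) (f : P ⟶ X)
    [IsClosedImmersion i] [IsOpenImmersion v] [IsOpenImmersion j] [IsProper f]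
    [QuasiCompact (i ≫ j)] (h : IsCompl (Set.range i) (Set.range v)) :
    openValue b f j =
      openValue b ((i ≫ j).imageι ≫ f) (i ≫ j).toImage + openValue b f (v ≫ j) := by
  let d := (i ≫ j).imageι
  let D : Closeds P := ⟨Set.range d, d.isClosedEmbedding.isClosed_range⟩
  have hpb : IsPullback (i ≫ j).toImage i d j := isPullback_of_isDominant (by simp [d])
  have hv : boundary (v ≫ j) = D ⊔ boundary j := SetLike.coe_injective (boundary_comp hpb h)
  have hd : closedValue b (d ≫ f) (boundary (i ≫ j).toImage) =
      closedValue b f (D ⊓ boundary j) := by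
    rw [← preimage_boundary hpb]
    refine hb.closedValue_comp f d ?_
    rw [Closeds.coe_preimage, Set.image_preimage_eq_range_inter]
    rfl
  rw [openValue, openValue, openValue, hd, hv, hb.comp_eq_closedValue f d (C := D) rfl,
    eq_sub_of_add_eq ((hb.isValuationOn_closedValue f).map_sup_add_map_inf D (boundary j) trivial)]
  abel

theorem exists_isAdditiveOn_isCompactifiable [IsLocallyNoetherian X] :
    ∃ c : ∀ ⦃Y : Scheme.{u}⦄, (Y ⟶ X) → G, IsAdditiveOn IsCompactifiable c ∧
      ∀ ⦃Y : Scheme.{u}⦄ (f : Y ⟶ X) [IsProper f], c f = b f := by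
  have hval ⦃Y : Scheme.{u}⦄ (g : Y ⟶ X) : ∃ x : G, ∀ (P : Scheme.{u}) (f : P ⟶ X) (j : Y ⟶ P)
      [IsOpenImmersion j] [IsProper f], j ≫ f = g → x = openValue b f j := by
    by_cases hg : IsCompactifiable g
    · obtain ⟨P, f, j, _, _, rfl⟩ := hg
      exact ⟨openValue b f j, fun _ f' j' _ _ h ↦ hb.openValue_eq f f' j j' h.symm⟩
    · exact ⟨0, fun P f j _ _ h ↦ absurd ⟨P, f, j, ‹_›, ‹_›, h⟩ hg⟩
  choose c hc using hval
  refine ⟨c, ⟨fun Z U Y i v g _ _ ↦ ?_⟩, fun Y f _ ↦ ?_⟩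
  · rintro ⟨P, f, j, _, _, rfl⟩ hiv
    have := quasiCompact_of_comp_isProper (i ≫ j) f
    rw [hc (j ≫ f) P f j rfl, hb.openValue_add i v j f hiv,
      hc (i ≫ j ≫ f) _ ((i ≫ j).imageι ≫ f) (i ≫ j).toImage (by simp),
      hc (v ≫ j ≫ f) P f (v ≫ j) (Category.assoc ..)]
  · rw [hc f Y f (𝟙 Y) (Category.id_comp f), hb.openValue_id]

end IsAcyclic

end Compactification

section Affine

section AwayEval

open HomogeneousLocalization

variable {A R σ : Type*} [CommRing A] [CommRing R] [SetLike σ A] [AddSubgroupClass σ A]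
  (𝒜 : ℕ → σ) [GradedRing 𝒜] {t : A} (φ : A →+* R) (ht : φ t = 1)

/-- Evaluation of homogeneous fractions of degree zero at an `R`-valued point `φ` of `Spec A` with
`φ t = 1`. -/
noncomputable def awayEval : Away 𝒜 t →+* R :=
  (IsLocalization.Away.lift t (g := φ) (ht ▸ isUnit_one)).comp
    (algebraMap (Away 𝒜 t) (Localization.Away t))

lemma awayEval_fromZeroRingHom (a : 𝒜 0) :
    awayEval 𝒜 φ ht (fromZeroRingHom 𝒜 _ a) = φ a :=
  IsLocalization.Away.lift_eq t (ht ▸ isUnit_one) (a : A)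

lemma awayEval_mk {d n : ℕ} (htd : t ∈ 𝒜 d) (a : A) (ha : a ∈ 𝒜 (n • d)) :
    awayEval 𝒜 φ ht (Away.mk 𝒜 htd n a ha) = φ a := by
  change IsLocalization.Away.lift t (ht ▸ isUnit_one)
    (Localization.mk a (⟨t ^ n, n, rfl⟩ : Submonoid.powers t)) = φ a
  rw [Localization.mk_eq_mk', IsLocalization.Away.lift, IsLocalization.lift_mk'_spec]
  simp [ht]

lemma awayEval_surjective (ht₁ : t ∈ 𝒜 1) (hφ : Function.Surjective φ) :
    Function.Surjective (awayEval 𝒜 φ ht) := by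
  classical
  intro r
  obtain ⟨a, rfl⟩ := hφ r
  rw [← DirectSum.sum_support_decompose 𝒜 a, map_sum]
  exact sum_mem (S := (awayEval 𝒜 φ ht).range) fun n _ ↦
    ⟨Away.mk 𝒜 ht₁ n _ (by simp), awayEval_mk ..⟩

end AwayEval

section ProjOfEval

variable {A R : Type u} {σ : Type*} [CommRing A] [CommRing R] [SetLike σ A] [AddSubgroupClass σ A]
  (𝒜 : ℕ → σ) [GradedRing 𝒜] {t : A} (ht₁ : t ∈ 𝒜 1) (φ : A →+* R) (ht : φ t = 1)

/-- The `R`-valued point of `Proj 𝒜` with homogeneous coordinates `φ`, where the coordinate `t` is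
`1`. -/
noncomputable def projOfEval : Spec (.of R) ⟶ Proj 𝒜 :=
  Spec.map (CommRingCat.ofHom (awayEval 𝒜 φ ht)) ≫ Proj.awayι 𝒜 t ht₁ one_pos

lemma isImmersion_projOfEval (hφ : Function.Surjective φ) :
    IsImmersion (projOfEval 𝒜 ht₁ φ ht) := by
  have : IsClosedImmersion (Spec.map (CommRingCat.ofHom (awayEval 𝒜 φ ht))) :=
    IsClosedImmersion.spec_of_surjective _ (awayEval_surjective 𝒜 φ ht ht₁ hφ)
  unfold projOfEval
  infer_instance

lemma projOfEval_toSpecZero :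
    projOfEval 𝒜 ht₁ φ ht ≫ Proj.toSpecZero 𝒜 =
      Spec.map (CommRingCat.ofHom (φ.comp (algebraMap (𝒜 0) A))) := by
  rw [projOfEval, Category.assoc, Proj.awayι_toSpecZero, ← Spec.map_comp]
  congr 1
  ext a
  exact awayEval_fromZeroRingHom 𝒜 φ ht a

end ProjOfEval

section ProjectiveSpace

open MvPolynomial

variable (k : Type u) [CommRing k] (σ : Type*)

lemma algebraMap_homogeneousSubmodule_zero_surjective :
    Function.Surjective (algebraMap k (homogeneousSubmodule σ k 0)) := by
  rintro ⟨a, ha⟩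
  have h₀ : a.totalDegree = 0 := Nat.le_zero.mp (IsHomogeneous.totalDegree_le ha)
  exact ⟨_, Subtype.ext (totalDegree_eq_zero_iff_eq_C.mp h₀).symm⟩

lemma finiteType_homogeneousSubmodule_zero [Finite σ] :
    Algebra.FiniteType (homogeneousSubmodule σ k 0) (MvPolynomial σ k) :=
  have : IsScalarTower k (homogeneousSubmodule σ k 0) (MvPolynomial σ k) :=
    ⟨fun a b c ↦ smul_mul_assoc a b.1 c⟩
  Algebra.FiniteType.of_restrictScalars_finiteType k _ _

end ProjectiveSpace

open MvPolynomial in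
theorem exists_isImmersion_isProper (k R : Type u) [CommRing k] [CommRing R] [Algebra k R]
    [Algebra.FiniteType k R] :
    ∃ (P : Scheme.{u}) (π : P ⟶ Spec (.of k)) (j : Spec (.of R) ⟶ P), IsProper π ∧
      IsImmersion j ∧ j ≫ π = Spec.map (CommRingCat.ofHom (algebraMap k R)) := by
  obtain ⟨n, φ, hφ⟩ := Algebra.FiniteType.iff_quotient_mvPolynomial''.mp ‹Algebra.FiniteType k R›
  -- `Proj 𝒜` is projective `n`-space, with `X none` the homogenizing coordinate.
  let 𝒜 := homogeneousSubmodule (Option (Fin n)) k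
  let _ : GradedAlgebra 𝒜 := MvPolynomial.gradedAlgebra
  let ev : MvPolynomial (Option (Fin n)) k →ₐ[k] R := aeval fun o ↦ o.elim 1 fun i ↦ φ (X i)
  have hev : ev (X none) = 1 := by simp [ev]
  have hev_surj : Function.Surjective ev := by
    have hcomp : ev.comp (rename some) = φ := by
      ext i
      simp [ev]
    exact .of_comp (g := rename some) (by rwa [← AlgHom.coe_comp, hcomp])
  have ht : X none ∈ 𝒜 1 := isHomogeneous_X k none
  have := finiteType_homogeneousSubmodule_zero k (Option (Fin n))
  have : IsClosedImmersion (Spec.map (CommRingCat.ofHom (algebraMap k (𝒜 0)))) :=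
    IsClosedImmersion.spec_of_surjective _ (algebraMap_homogeneousSubmodule_zero_surjective k _)
  refine ⟨Proj 𝒜, Proj.toSpecZero 𝒜 ≫ Spec.map (CommRingCat.ofHom (algebraMap k (𝒜 0))),
    projOfEval 𝒜 ht ev.toRingHom hev, inferInstance,
    isImmersion_projOfEval 𝒜 ht ev.toRingHom hev hev_surj, ?_⟩
  rw [← Category.assoc, projOfEval_toSpecZero, ← Spec.map_comp]
  exact congrArg (fun ψ ↦ Spec.map (CommRingCat.ofHom ψ)) ev.comp_algebraMap

theorem exists_isImmersion_isProper_of_isAffine {k : Type u} [CommRing k] {U : Scheme.{u}}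
    [IsAffine U] (h : U ⟶ Spec (.of k)) [LocallyOfFiniteType h] :
    ∃ (P : Scheme.{u}) (π : P ⟶ Spec (.of k)) (j : U ⟶ P), IsProper π ∧ IsImmersion j ∧
      j ≫ π = h := by
  obtain ⟨φ, hφ⟩ := Spec.map_surjective (U.isoSpec.inv ≫ h)
  have : LocallyOfFiniteType (Spec.map φ) := hφ ▸ inferInstance
  have hft : φ.hom.FiniteType := HasRingHomProperty.Spec_iff.mp this
  algebraize [φ.hom]
  obtain ⟨P, π, j, hπ, hj, hjπ⟩ := exists_isImmersion_isProper k Γ(U, ⊤)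
  refine ⟨P, π, U.isoSpec.hom ≫ j, hπ, inferInstance, ?_⟩
  rw [Category.assoc, ← Iso.eq_inv_comp]
  exact hjπ.trans hφ

lemma isCompactifiable_of_isAffine {k : Type u} [CommRing k] {X : Scheme.{u}}
    [IsLocallyNoetherian X] (p : X ⟶ Spec (.of k)) {U : Scheme.{u}} [IsAffine U] (g : U ⟶ X)
    [LocallyOfFiniteType (g ≫ p)] : IsCompactifiable g := by
  obtain ⟨P, π, j, _, _, h⟩ := exists_isImmersion_isProper_of_isAffine (g ≫ p)
  let l : U ⟶ pullback p π := pullback.lift g j h.symm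
  have hl : l ≫ pullback.snd p π = j := pullback.lift_snd _ _ _
  have : IsImmersion (l ≫ pullback.snd p π) := hl ▸ ‹_›
  have : IsImmersion l := .of_comp l (pullback.snd p π)
  have := quasiCompact_of_comp_isProper l (pullback.fst p π)
  rw [← pullback.lift_fst g j h.symm]
  exact isCompactifiable_of_isImmersion l (pullback.fst p π)

lemma hasFiniteOpenCover_isCompactifiable {k : Type u} [CommRing k] {X : Scheme.{u}}
    [IsLocallyNoetherian X] (p : X ⟶ Spec (.of k)) {Y : Scheme.{u}} [CompactSpace Y] (g : Y ⟶ X)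
    [LocallyOfFiniteType (g ≫ p)] : HasFiniteOpenCover IsCompactifiable g := by
  have htop : IsCompactElement (⊤ : Y.Opens) := (Opens.isCompactElement_iff _).mpr isCompact_univ
  rw [CompleteLattice.isCompactElement_iff_exists_le_sSup_of_le_sSup] at htop
  obtain ⟨s, hs, hcover⟩ := htop Y.affineOpens (by
    rw [sSup_eq_iSup', iSup_affineOpens_eq_top])
  refine ⟨s, fun V hV ↦ ?_, top_le_iff.mp hcover⟩
  have : IsAffine V := hs hV
  have : LocallyOfFiniteType ((V.ι ≫ g) ≫ p) := by
    rw [Category.assoc]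
    infer_instance
  exact isCompactifiable_of_isAffine p (V.ι ≫ g)

end Affine

section Comparison

variable {k : Type u} [Field k] {X : Scheme.{u}} {p : X ⟶ Spec (CommRingCat.of k)}
  {G : Type*} [AddCommGroup G] {c c' : ∀ ⦃Y : Scheme.{u}⦄, (Y ⟶ X) → G}

lemma IsVariety.isNoetherian (hX : IsVariety k p) : IsNoetherian X :=
  have := hX.locallyOfFiniteType
  have := hX.quasiCompact
  have := LocallyOfFiniteType.isLocallyNoetherian p
  have := QuasiCompact.compactSpace_of_compactSpace p
  ⟨⟩

lemma IsVariety.comp (hX : IsVariety k p) {Y : Scheme.{u}} (g : Y ⟶ X) [IsSeparated g]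
    [LocallyOfFiniteType g] [QuasiCompact g] : IsVariety k (g ≫ p) :=
  have := hX.isSeparated
  have := hX.locallyOfFiniteType
  have := hX.quasiCompact
  ⟨inferInstance, inferInstance, inferInstance⟩

/-- The property `isVar p` of varieties over `X`, unbundled from `Over X`. -/
abbrev IsVarietyOver (p : X ⟶ Spec (CommRingCat.of k)) ⦃Y : Scheme.{u}⦄ (g : Y ⟶ X) : Prop :=
  IsVariety k (g ≫ p)

lemma isStable_isVarietyOver : IsStable (IsVarietyOver p) where
  comp Z Y i _ g hg := by
    have := hg.isNoetherian
    have := quasiCompact_of_isImmersion i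
    rw [IsVarietyOver, Category.assoc]
    exact hg.comp i

lemma IsVarietyOver.hasFiniteOpenCover [IsLocallyNoetherian X] {Y : Scheme.{u}} (g : Y ⟶ X)
    (hg : IsVarietyOver p g) : HasFiniteOpenCover IsCompactifiable g :=
  have := hg.isNoetherian
  have := hg.locallyOfFiniteType
  hasFiniteOpenCover_isCompactifiable p g

theorem IsAcyclic.exists_isAdditiveOn_isVarietyOver (hX : IsVariety k p) (hc : IsAcyclic c) :
    ∃ c' : ∀ ⦃Y : Scheme.{u}⦄, (Y ⟶ X) → G, IsAdditiveOn (IsVarietyOver p) c' ∧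
      ∀ ⦃Y : Scheme.{u}⦄ (f : Y ⟶ X) [IsProper f], c' f = c f := by
  have := hX.isNoetherian
  obtain ⟨c₀, hc₀, hproper⟩ := hc.exists_isAdditiveOn_isCompactifiable
  obtain ⟨c', hc', hc'c₀⟩ := hc₀.exists_extension isStable_isCompactifiable
  refine ⟨c', hc'.mono fun _ g hg ↦ hg.hasFiniteOpenCover, fun Y f _ ↦ ?_⟩
  rw [hc'c₀ f ⟨Y, f, 𝟙 Y, ‹_›, inferInstance, Category.id_comp f⟩, hproper]

theorem IsAdditiveOn.eq_of_eq_on_proper (hX : IsVariety k p) (hc : IsAdditiveOn (IsVarietyOver p) c)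
    (hc' : IsAdditiveOn (IsVarietyOver p) c')
    (h : ∀ ⦃Y : Scheme.{u}⦄ (f : Y ⟶ X) [IsProper f], c f = c' f) {Y : Scheme.{u}} (g : Y ⟶ X)
    (hg : IsVarietyOver p g) : c g = c' g := by
  have := hX.isNoetherian
  refine hc.eq_of_hasFiniteOpenCover isStable_isCompactifiable isStable_isVarietyOver hc'
    (fun V hV ↦ ?_) hg hg.hasFiniteOpenCover
  obtain ⟨P, f, j, _, _, hjf⟩ := hV
  have hcompl : IsCompl (Set.range (reducedι (boundary j))) (Set.range j) := by
    rw [range_reducedι]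
    exact isCompl_compl.symm
  have hadd := hc.add _ j f (hX.comp f) hcompl
  rw [h, h, hc'.add _ j f (hX.comp f) hcompl, add_right_inj] at hadd
  rw [← hjf, hadd]

open Classical in
/-- The class of `g : Y ⟶ X` in `K₀(var/X)`, with junk value `0` if `Y` is not a variety. -/
noncomputable def k0Class (p : X ⟶ Spec (CommRingCat.of k)) ⦃Y : Scheme.{u}⦄ (g : Y ⟶ X) : K0 p :=
  if h : IsVarietyOver p g then QuotientAddGroup.mk (varClass ⟨Over.mk g, h⟩) else 0

lemma k0Class_hom (Y : Var p) : k0Class p Y.obj.hom = QuotientAddGroup.mk (varClass Y) :=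
  dif_pos Y.property

lemma isAdditiveOn_k0Class : IsAdditiveOn (IsVarietyOver p) (k0Class p) where
  add Z U Y i j g _ _ hg hij := by
    let Y' : Var p := ⟨Over.mk g, hg⟩
    let Z' : Var p := ⟨Over.mk (i ≫ g), isStable_isVarietyOver.comp i g hg⟩
    let U' : Var p := ⟨Over.mk (j ≫ g), isStable_isVarietyOver.comp j g hg⟩
    have hrange : Set.range j = Set.range (complement i).ι :=
      hij.compl_eq.symm.trans (complement i).range_ι.symm
    let e : U'.obj ≅ Over.mk ((complement i).ι ≫ Y'.obj.hom) :=
      Over.isoMk (IsOpenImmersion.isoOfRangeEq j (complement i).ι hrange)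
        (IsOpenImmersion.isoOfRangeEq_hom_fac_assoc ..)
    let i' : Z'.obj ⟶ Y'.obj := Over.homMk i
    have : IsClosedImmersion i'.left := ‹IsClosedImmersion i›
    have hrel : (varClass Y' - varClass Z' - varClass U' : IsoVar p) ∈
        AddSubgroup.closure {x | AddRel p x} :=
      AddSubgroup.subset_closure (.mk Y' Z' U' i' e)
    have hzero := (QuotientAddGroup.eq_zero_iff _).mpr hrel
    rw [QuotientAddGroup.mk_sub, QuotientAddGroup.mk_sub, ← k0Class_hom, ← k0Class_hom,
      ← k0Class_hom, sub_sub, sub_eq_zero] at hzero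
    exact hzero

open Classical in
/-- The class of `g : Y ⟶ X` modulo the acyclicity relation, with junk value `0` if `Y` is not a
variety proper over `X`. -/
noncomputable def acClass (p : X ⟶ Spec (CommRingCat.of k)) ⦃Y : Scheme.{u}⦄ (g : Y ⟶ X) :
    IsoPrModAc p :=
  if h : IsVarietyOver p g ∧ IsProper g then QuotientAddGroup.mk (properClass ⟨Over.mk g, h⟩)
  else 0

lemma acClass_hom (Y : ProperVar p) :
    acClass p Y.obj.hom = QuotientAddGroup.mk (properClass Y) :=
  dif_pos Y.property

lemma isAcyclic_acClass (hX : IsVariety k p) : IsAcyclic (acClass p) where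
  of_isEmpty Y _ f := by
    rw [acClass]
    split_ifs with h
    · exact (QuotientAddGroup.eq_zero_iff _).mpr
        (AddSubgroup.subset_closure (.empty ⟨Over.mk f, h⟩ ‹_›))
    · rfl
  sub_eq_sub Y Y' Z f q i _ _ _ hiso := by
    let proper {W : Scheme.{u}} (g : W ⟶ X) [hg : IsProper g] : ProperVar p :=
      ⟨Over.mk g, hX.comp g, hg⟩
    let i' : (proper (pullback.fst q i ≫ q ≫ f)).obj ⟶ (proper (q ≫ f)).obj :=
      Over.homMk (pullback.fst q i)
    let q' : (proper (pullback.fst q i ≫ q ≫ f)).obj ⟶ (proper (i ≫ f)).obj :=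
      Over.homMk (pullback.snd q i) (pullback.condition_assoc f).symm
    let q₀ : (proper (q ≫ f)).obj ⟶ (proper f).obj := Over.homMk q
    let i₀ : (proper (i ≫ f)).obj ⟶ (proper f).obj := Over.homMk i
    have : IsProper q₀.left := ‹IsProper q›
    have : IsClosedImmersion i₀.left := ‹IsClosedImmersion i›
    have hrel := AddSubgroup.subset_closure (k := {x | AcRel p x})
      (AcRel.square _ _ _ _ i' q' q₀ i₀ (.of_hasPullback q i) hiso)
    have hzero := (QuotientAddGroup.eq_zero_iff _).mpr hrel
    simp only [QuotientAddGroup.mk_sub, ← acClass_hom, sub_eq_zero] at hzero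
    exact hzero

lemma IsAdditiveOn.hom_eq_of_iso (hc : IsAdditiveOn (IsVarietyOver p) c) {Y Y' : Over X}
    (e : Y' ≅ Y) (hY : IsVarietyOver p Y.hom) : c Y'.hom = c Y.hom := by
  have : IsIso e.hom.left := inferInstanceAs (IsIso ((Over.forget X).map e.hom))
  rw [← Over.w e.hom]
  exact hc.of_isIso isStable_isVarietyOver _ _ hY

/-- The homomorphism out of `K₀(var/X)` induced by an additive invariant. -/
noncomputable def K0.lift (hc : IsAdditiveOn (IsVarietyOver p) c) : K0 p →+ G :=
  QuotientAddGroup.lift _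
    (FreeAbelianGroup.lift (Quotient.lift (fun Y : Var p ↦ c Y.obj.hom) fun _ Y ⟨e⟩ ↦
      hc.hom_eq_of_iso ((isVar p).ι.mapIso e) Y.property))
    ((AddSubgroup.closure_le _).mpr <| by
      rintro _ ⟨Y, Z, U, i, e⟩
      have hU := hc.hom_eq_of_iso e (isStable_isVarietyOver.comp _ _ Y.property)
      have hY := hc.add i.left (complement i.left).ι Y.obj.hom Y.property (by
        rw [Scheme.Opens.range_ι]
        exact isCompl_compl)
      rw [Over.w] at hY
      simp [varClass, hY, hU])

lemma K0.lift_varClass (hc : IsAdditiveOn (IsVarietyOver p) c) (Y : Var p) :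
    K0.lift hc (QuotientAddGroup.mk (varClass Y)) = c Y.obj.hom :=
  FreeAbelianGroup.lift_apply_of _ _

/-- The homomorphism out of the proper classes modulo acyclicity induced by an additive
invariant. -/
noncomputable def IsoPrModAc.lift (hc : IsAdditiveOn (IsVarietyOver p) c) : IsoPrModAc p →+ G :=
  QuotientAddGroup.lift _
    (FreeAbelianGroup.lift (Quotient.lift (fun Y : ProperVar p ↦ c Y.obj.hom) fun _ Y ⟨e⟩ ↦
      hc.hom_eq_of_iso ((isProperVar p).ι.mapIso e) Y.property.1))
    ((AddSubgroup.closure_le _).mpr <| by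
      rintro _ (⟨E, _⟩ | ⟨Xt, Zt, X', Z', i', q', q, i, cart, iso⟩)
      · simpa [properClass] using hc.of_isEmpty _ E.property.1
      · have := hc.sub_eq_sub_of_isPullback isStable_isVarietyOver cart iso X'.obj.hom
          X'.property.1 (by simpa only [Over.w] using Xt.property.1)
        simp only [Over.w] at this
        simp [properClass, this])

lemma IsoPrModAc.lift_properClass (hc : IsAdditiveOn (IsVarietyOver p) c) (Y : ProperVar p) :
    IsoPrModAc.lift hc (QuotientAddGroup.mk (properClass Y)) = c Y.obj.hom :=
  FreeAbelianGroup.lift_apply_of _ _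

lemma IsoPrModAc.lift_acClass (hX : IsVariety k p) (hc : IsAdditiveOn (IsVarietyOver p) c)
    {Y : Scheme.{u}} (f : Y ⟶ X) [IsProper f] : IsoPrModAc.lift hc (acClass p f) = c f := by
  let Y' : ProperVar p := ⟨Over.mk f, hX.comp f, ‹_›⟩
  exact (congrArg _ (acClass_hom Y')).trans (IsoPrModAc.lift_properClass hc Y')

end Comparison

end RelativeGrothendieck

open RelativeGrothendieck in
theorem mainTheorem8_general (k : Type u) [Field k] (X : Scheme.{u})
    (p : X ⟶ Spec (CommRingCat.of k)) (hX : IsVariety k p) :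
    ∃ e : IsoPrModAc p ≃+ K0 p, ∀ Y : ProperVar p,
      e (QuotientAddGroup.mk (properClass Y)) = QuotientAddGroup.mk (varClass Y.toVar) := by
  obtain ⟨c, hc, hproper⟩ := (isAcyclic_acClass hX).exists_isAdditiveOn_isVarietyOver hX
  let toK0 : IsoPrModAc p →+ K0 p := IsoPrModAc.lift isAdditiveOn_k0Class
  have toK0_mk (Y : ProperVar p) : toK0 (QuotientAddGroup.mk (properClass Y)) =
      QuotientAddGroup.mk (varClass Y.toVar) :=
    (IsoPrModAc.lift_properClass _ Y).trans (k0Class_hom Y.toVar)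
  have toK0_c ⦃Z : Scheme.{u}⦄ (f : Z ⟶ X) [IsProper f] : toK0 (c f) = k0Class p f := by
    rw [hproper, IsoPrModAc.lift_acClass hX]
  refine ⟨toK0.toAddEquiv (K0.lift hc) ?_ ?_, toK0_mk⟩
  · ext ⟨Y⟩
    have : IsProper Y.obj.hom := Y.property.2
    change K0.lift hc (toK0 (QuotientAddGroup.mk (properClass Y))) = _
    rw [toK0_mk, K0.lift_varClass]
    exact (hproper Y.obj.hom).trans (acClass_hom Y)
  · ext ⟨Y⟩
    change toK0 (K0.lift hc (QuotientAddGroup.mk (varClass Y))) = _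
    rw [K0.lift_varClass,
      (hc.map toK0).eq_of_eq_on_proper hX isAdditiveOn_k0Class toK0_c Y.obj.hom Y.property]
    exact k0Class_hom Y

theorem mainTheorem8 (k : Type u) [Field k] [CharZero k] (X : Scheme.{u})
    (p : X ⟶ Spec (CommRingCat.of k)) (hX : RelativeGrothendieck.IsVariety k p) :
    ∃ e : RelativeGrothendieck.IsoPrModAc p ≃+ RelativeGrothendieck.K0 p,
      ∀ Y : RelativeGrothendieck.ProperVar p,
        e (QuotientAddGroup.mk (RelativeGrothendieck.properClass Y)) =
          QuotientAddGroup.mk (RelativeGrothendieck.varClass Y.toVar) :=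
  mainTheorem8_general k X p hX
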